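/- Let $\gamma\in(0,1)$, $\mu_T\in\mathbb{C}$, $\sigma_T^2\ge 0$ with $(\mu_T,\sigma_T^2)\ne(0,0)$, and $\mathsf{snr}\ge 0$. Let $X$ be a complex Bernoulli-Gaussian random variable, i.e. with law $(1-\gamma)\,\delta_0+\gamma\,\mathcal{CN}(\mu_T,\sigma_T^2)$ (for $\sigma_T^2=0$, $\mathcal{CN}(\mu_T,0)$ is the point mass at $\mu_T$), let $Z\sim\mathcal{CN}(0,1)$ be independent of $X$, and let $Y=\sqrt{\mathsf{snr}}\,X+Z$. Let $\delta\in\mathbb{R}$ and let $g:\mathbb{C}\to\{0,1\}$ be a Neyman–Pearson detector with threshold $\delta$: with $\hat\gamma(y)=\mathbb{P}[X\neq 0\mid Y=y]$, $$g(y)=0\ \text{ if }\ \frac{\hat\gamma(y)}{1-\hat\gamma(y)}<\frac{\gamma}{1-\gamma}\,\delta,\qquad g(y)=1\ \text{ if }\ \frac{\hat\gamma(y)}{1-\hat\gamma(y)}>\frac{\gamma}{1-\gamma}\,\delta,$$ for almost every $y$ with respect to the law of $Y$, ties being broken in any measurable way. Let $P_{FA}=\mathbb{P}[g(Y)=1\mid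 X=0]$ and $P_{MD}=\mathbb{P}[g(Y)=0\mid X\ne 0]$ be its false-alarm and misdetection probabilities. With $H_b(p)=-p\log_2 p-(1-p)\log_2(1-p)$ (where $0\log_2 0=0$) and $$H_{NP}(\gamma,P_{FA},P_{MD})=H_b(\gamma)+(1-\gamma)H_b(P_{FA})+\gamma H_b(P_{MD})-H_b\big((1-\gamma)P_{FA}+\gamma(1-P_{MD})\big),$$ the sensing rate $I(X;Y)$ (mutual information, in bits) satisfies $$I(X;Y)\ \ge\ H_b(\gamma)-H_{NP}(\gamma,P_{FA},P_{MD})+\gamma\log_2\!\big(1+\mathsf{snr}\,\sigma_T^2\big).$$ -/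

import Mathlib

open MeasureTheory ProbabilityTheory
open scoped ENNReal NNReal

noncomputable section

namespace BGSensing

/-- The circularly symmetric complex Gaussian law `CN(m, v)`: the real and imaginary parts are
independent real Gaussians, each of variance `v / 2`. For `v > 0` its density is
`exp (-|x - m|^2 / v) / (π v)`; for `v = 0` it is the point mass at `m`. -/
def complexGaussian (m : ℂ) (v : ℝ≥0) : Measure ℂ :=
  ((gaussianReal m.re (v / 2)).prod (gaussianReal m.im (v / 2))).map
    (fun p : ℝ × ℝ => (⟨p.1, p.2⟩ : ℂ))

/-- The Bernoulli-Gaussian law `BG(μ, v, γ) = (1 - γ) δ_0 + γ CN(μ, v)`. -/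
def bernoulliGaussian (μT : ℂ) (v : ℝ≥0) (γ : ℝ) : Measure ℂ :=
  ENNReal.ofReal (1 - γ) • Measure.dirac 0 + ENNReal.ofReal γ • complexGaussian μT v

variable {Ω : Type*} [MeasurableSpace Ω]

/-- Received signal `Y = √snr X + Z`. -/
def received (snr : ℝ) (X Z : Ω → ℂ) : Ω → ℂ :=
  fun ω => (Real.sqrt snr : ℂ) * X ω + Z ω

/-- Mutual information `I(X; Y)` in bits, as an element of `[0, ∞]`: the Kullback-Leibler divergence
(in nats) of the joint law from the product of the marginal laws, divided by `ln 2`. -/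
def mutualInfoBits (P : Measure Ω) (X Y : Ω → ℂ) : ℝ≥0∞ :=
  InformationTheory.klDiv (P.map (fun ω => (X ω, Y ω))) ((P.map X).prod (P.map Y))
    / ENNReal.ofReal (Real.log 2)

/-- The posterior probability of target presence, `P[X ≠ 0 | Y = y]`, through the regular
conditional distribution of `X` given `Y`. -/
def presencePosterior (P : Measure Ω) [IsFiniteMeasure P] (X Y : Ω → ℂ) (y : ℂ) : ℝ :=
  (condDistrib X Y P y).real ({0}ᶜ : Set ℂ)

/-- `g` is a Neyman-Pearson detector with threshold `δ`: writing `q = P[X ≠ 0 | Y = y]`, it decides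
`0` where `q / (1 - q) < γ / (1 - γ) * δ` and `1` where `q / (1 - q) > γ / (1 - γ) * δ` (both
written without denominators); ties may be broken in any measurable way. As the posterior is only
determined up to null sets of the law of `Y`, so is the rule. -/
def IsNeymanPearson (P : Measure Ω) [IsFiniteMeasure P] (X Y : Ω → ℂ) (γ δ : ℝ)
    (g : ℂ → Fin 2) : Prop :=
  Measurable g ∧ ∀ᵐ y ∂(P.map Y),
    (presencePosterior P X Y y * (1 - γ) < (1 - presencePosterior P X Y y) * γ * δ → g y = 0) ∧
    ((1 - presencePosterior P X Y y) * γ * δ < presencePosterior P X Y y * (1 - γ) → g y = 1)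

/-- False-alarm probability `P[g(Y) = 1 | X = 0]`. -/
def probFA (P : Measure Ω) (X Y : Ω → ℂ) (g : ℂ → Fin 2) : ℝ :=
  (ProbabilityTheory.cond P {ω | X ω = 0}).real {ω | g (Y ω) = 1}

/-- Misdetection probability `P[g(Y) = 0 | X ≠ 0]`. -/
def probMD (P : Measure Ω) (X Y : Ω → ℂ) (g : ℂ → Fin 2) : ℝ :=
  (ProbabilityTheory.cond P {ω | X ω ≠ 0}).real {ω | g (Y ω) = 0}

/-- Binary entropy in bits. -/
def Hb (p : ℝ) : ℝ := -p * Real.logb 2 p - (1 - p) * Real.logb 2 (1 - p)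

/-- Remaining uncertainty after detection. -/
def HNP (γ pFA pMD : ℝ) : ℝ :=
  Hb γ + (1 - γ) * Hb pFA + γ * Hb pMD - Hb ((1 - γ) * pFA + γ * (1 - pMD))

end BGSensing

end

/-! Mutual information is the divergence of the joint law from the product of the marginals, so by
the Gibbs bound (`integral_log_le_toReal_klDiv`) any test function `H` of mass at most one under the
product gives the lower bound `E[log H]`. Let `N0`, `N1` be the output laws given absence and
presence, `ν` their mixture, and `A0`, `A1` the likelihood ratios of `N0`, `N1` to `ν` seen through
`g`. Take `H(x, y) = A0(y)` for `x = 0`, and `A1(y)` times the Gaussian channel density `p(y|x) /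
p_N1(y)` for `x ≠ 0`. Averaging `p(y|x)` over the Gaussian input returns `p_N1(y)`, which gives the
mass bound (`lintegral_channelRatio`). In the expectation of `log H`, the channel factor contributes
the Gaussian capacity `log (1 + snr σ²)` with weight `γ` (`integral_log_channelRatio`), and the
factors `A0`, `A1` contribute the information between presence and decision, which is `Hb γ - HNP`
(`Hb_sub_HNP_eq`). `le_toReal_klDiv_channelJoint` combines the two. -/

namespace BGSensing

/-! ### Variational bound for the divergence. -/

/-- Gibbs variational lower bound: a nonnegative function of mass at most one under the reference
measure is a test function for the Kullback-Leibler divergence. -/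
lemma integral_log_le_toReal_klDiv {α : Type*} [MeasurableSpace α] {μ ν : Measure α}
    [IsProbabilityMeasure μ] [IsProbabilityMeasure ν] (hac : μ ≪ ν)
    (hllr : Integrable (llr μ ν) μ) {h : α → ℝ} (hm : Measurable h)
    (hpos : ∀ᵐ x ∂μ, 0 < h x) (hint : Integrable (fun x => Real.log (h x)) μ)
    (hmass : ∫⁻ x, ENNReal.ofReal (h x) ∂ν ≤ 1) :
    ∫ x, Real.log (h x) ∂μ ≤ (InformationTheory.klDiv μ ν).toReal := by
  rw [InformationTheory.toReal_klDiv_of_measure_eq hac (by simp)]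
  set r : α → ℝ≥0∞ := μ.rnDeriv ν with hr
  have hrpos : ∀ᵐ x ∂μ, 0 < r x := Measure.rnDeriv_pos hac
  have hrfin : ∀ᵐ x ∂μ, r x < ∞ := hac.ae_le (Measure.rnDeriv_lt_top μ ν)
  -- Passing from `μ` to `ν` cancels `r`; the mass of `h` where `r = 0` is lost, hence only an
  -- inequality.
  have hle : ∫⁻ x, ENNReal.ofReal (h x / (r x).toReal) ∂μ ≤ 1 := by
    calc ∫⁻ x, ENNReal.ofReal (h x / (r x).toReal) ∂μ
        = ∫⁻ x, r x * ENNReal.ofReal (h x / (r x).toReal) ∂ν := by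
          rw [lintegral_rnDeriv_mul hac]
          have := Measure.measurable_rnDeriv μ ν
          fun_prop
      _ ≤ ∫⁻ x, ENNReal.ofReal (h x) ∂ν := by
          refine lintegral_mono_ae ?_
          filter_upwards [Measure.rnDeriv_lt_top μ ν] with x hx
          change r x < ∞ at hx
          rcases eq_or_ne (r x) 0 with h0 | h0
          · simp [h0]
          · have hp : 0 < (r x).toReal := ENNReal.toReal_pos h0 hx.ne
            nth_rewrite 1 [← ENNReal.ofReal_toReal hx.ne]
            rw [← ENNReal.ofReal_mul hp.le, mul_div_cancel₀ _ hp.ne']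
      _ ≤ 1 := hmass
  have hnn : 0 ≤ᵐ[μ] fun x => h x / (r x).toReal := by
    filter_upwards [hpos] with x hx
    have : 0 ≤ (r x).toReal := ENNReal.toReal_nonneg
    positivity
  have hmeas : AEStronglyMeasurable (fun x => h x / (r x).toReal) μ := by
    have := Measure.measurable_rnDeriv μ ν
    exact Measurable.aestronglyMeasurable (by fun_prop)
  have hint2 : Integrable (fun x => h x / (r x).toReal) μ :=
    ⟨hmeas, by rw [hasFiniteIntegral_iff_ofReal hnn]; exact hle.trans_lt ENNReal.one_lt_top⟩
  have hI : ∫ x, h x / (r x).toReal ∂μ ≤ 1 := by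
    rw [integral_eq_lintegral_of_nonneg_ae hnn hmeas]
    exact ENNReal.toReal_le_of_le_ofReal zero_le_one (by simpa using hle)
  -- `log t ≤ t - 1` at `t = h / r`; the right side then integrates to at most `0`.
  have hkey : ∫ x, (Real.log (h x) - llr μ ν x) ∂μ ≤ ∫ x, (h x / (r x).toReal - 1) ∂μ := by
    refine integral_mono_ae (hint.sub hllr) (hint2.sub (integrable_const 1)) ?_
    filter_upwards [hpos, hrpos, hrfin] with x h1 h2 h3
    have hp : 0 < (r x).toReal := ENNReal.toReal_pos h2.ne' h3.ne
    have := Real.log_le_sub_one_of_pos (div_pos h1 hp)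
    rwa [Real.log_div h1.ne' hp.ne'] at this
  rw [integral_sub hint hllr, integral_sub hint2 (integrable_const 1)] at hkey
  simp at hkey
  linarith

/-! ### Complex Gaussian laws: density, affine images, second moments. -/

/-- The density of `CN(m, v)` with respect to Lebesgue measure on `ℂ`. -/
noncomputable def complexGaussianPDF (m : ℂ) (v : ℝ) (y : ℂ) : ℝ :=
  (Real.pi * v)⁻¹ * Real.exp (-Complex.normSq (y - m) / v)

lemma complexGaussianPDF_pos (m : ℂ) {v : ℝ} (hv : 0 < v) (y : ℂ) :
    0 < complexGaussianPDF m v y := by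
  unfold complexGaussianPDF; positivity

lemma measurable_normSq : Measurable Complex.normSq := Complex.continuous_normSq.measurable

lemma measurable_complexGaussianPDF (m : ℂ) (v : ℝ) : Measurable (complexGaussianPDF m v) := by
  unfold complexGaussianPDF
  have := measurable_normSq
  fun_prop

lemma measurable_complexMk : Measurable (fun p : ℝ × ℝ => (⟨p.1, p.2⟩ : ℂ)) :=
  Complex.measurableEquivRealProd.symm.measurable

lemma measurable_comp_complexMk {α : Type*} [MeasurableSpace α] {F : ℂ → ℝ≥0∞} (hF : Measurable F)
    {f g : α → ℝ} (hf : Measurable f) (hg : Measurable g) :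
    Measurable (fun x => F ⟨f x, g x⟩) :=
  hF.comp (measurable_complexMk.comp (hf.prodMk hg))

instance (m : ℂ) (v : ℝ≥0) : IsProbabilityMeasure (complexGaussian m v) :=
  Measure.isProbabilityMeasure_map measurable_complexMk.aemeasurable

lemma complexGaussian_map_re (m : ℂ) (v : ℝ≥0) :
    (complexGaussian m v).map Complex.re = gaussianReal m.re (v / 2) := by
  rw [complexGaussian, Measure.map_map Complex.measurable_re measurable_complexMk]
  exact Measure.fst_prod

lemma complexGaussian_map_im (m : ℂ) (v : ℝ≥0) :
    (complexGaussian m v).map Complex.im = gaussianReal m.im (v / 2) := by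
  rw [complexGaussian, Measure.map_map Complex.measurable_im measurable_complexMk]
  exact Measure.snd_prod

lemma lintegral_complexGaussian (m : ℂ) (v : ℝ≥0) {F : ℂ → ℝ≥0∞} (hF : Measurable F) :
    ∫⁻ y, F y ∂(complexGaussian m v)
      = ∫⁻ a, ∫⁻ b, F ⟨a, b⟩ ∂(gaussianReal m.im (v / 2)) ∂(gaussianReal m.re (v / 2)) := by
  rw [complexGaussian, lintegral_map hF measurable_complexMk,
    lintegral_prod (fun p : ℝ × ℝ => F ⟨p.1, p.2⟩) (hF.comp measurable_complexMk).aemeasurable]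

lemma complexGaussian_eq_withDensity (m : ℂ) {v : ℝ≥0} (hv : v ≠ 0) :
    complexGaussian m v
      = volume.withDensity (fun y => ENNReal.ofReal (complexGaussianPDF m v y)) := by
  have hv2 : v / 2 ≠ 0 := by simpa using hv
  have hmeas := (measurable_complexGaussianPDF m v).ennreal_ofReal
  ext s hs
  rw [complexGaussian, Measure.map_apply measurable_complexMk hs,
    gaussianReal_of_var_ne_zero _ hv2, gaussianReal_of_var_ne_zero _ hv2,
    prod_withDensity (measurable_gaussianPDF _ _) (measurable_gaussianPDF _ _),
    withDensity_apply _ (measurable_complexMk hs), withDensity_apply _ hs,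
    ← Measure.volume_eq_prod,
    ← (Complex.volume_preserving_equiv_real_prod.symm).setLIntegral_comp_preimage hs hmeas]
  refine lintegral_congr fun p => ?_
  rw [gaussianPDF, gaussianPDF, ← ENNReal.ofReal_mul (gaussianPDFReal_nonneg _ _ _)]
  congr 1
  have hvp : 0 < (v : ℝ) := by positivity
  simp only [gaussianPDFReal, complexGaussianPDF, Complex.measurableEquivRealProd_symm_apply,
    Complex.normSq_apply, Complex.sub_re, Complex.sub_im, NNReal.coe_div, NNReal.coe_ofNat]
  rw [mul_mul_mul_comm, ← Real.exp_add, ← mul_inv, Real.mul_self_sqrt (by positivity)]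
  congr 2
  · ring
  · field_simp
    ring

lemma complexGaussian_map_const_add (c : ℂ) (m : ℂ) (v : ℝ≥0) :
    (complexGaussian m v).map (fun z => c + z) = complexGaussian (c + m) v := by
  refine Measure.ext_of_lintegral _ fun F hF => ?_
  have h1 : ∀ (x a : ℝ) (w : ℝ≥0) (G : ℝ → ℝ≥0∞), Measurable G →
      ∫⁻ t, G (x + t) ∂(gaussianReal a w) = ∫⁻ t, G t ∂(gaussianReal (x + a) w) := by
    intro x a w G hG
    rw [add_comm x a, ← gaussianReal_map_const_add, lintegral_map hG (by fun_prop)]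
  rw [lintegral_map hF (by fun_prop), lintegral_complexGaussian _ _ (by fun_prop),
    lintegral_complexGaussian _ _ hF]
  have hG : Measurable fun a : ℝ =>
      ∫⁻ b, F ⟨a, b⟩ ∂(gaussianReal (c + m).im (v / 2)) :=
    Measurable.lintegral_prod_right' (f := fun p : ℝ × ℝ => F ⟨p.1, p.2⟩)
      (hF.comp measurable_complexMk)
  rw [Complex.add_re, ← h1 _ _ _ _ hG]
  refine lintegral_congr fun a => ?_
  rw [Complex.add_im, ← h1 c.im m.im (v / 2) (fun b => F ⟨c.re + a, b⟩)
    (measurable_comp_complexMk hF measurable_const measurable_id)]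
  refine lintegral_congr fun b => ?_
  congr 1

lemma gaussianReal_prod_map_mul_add (c m n : ℝ) (v w : ℝ≥0) :
    ((gaussianReal m v).prod (gaussianReal n w)).map (fun p : ℝ × ℝ => c * p.1 + p.2)
      = gaussianReal (c * m + n) (.mk (c ^ 2) (sq_nonneg _) * v + w) := by
  rw [← gaussianReal_conv_gaussianReal, ← gaussianReal_map_const_mul, Measure.conv]
  have : ((gaussianReal m v).map (c * ·)).prod (gaussianReal n w)
      = ((gaussianReal m v).prod (gaussianReal n w)).map (Prod.map (c * ·) id) := by
    rw [← Measure.map_prod_map _ _ (by fun_prop) measurable_id, Measure.map_id]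
  rw [this, Measure.map_map (by fun_prop) (by fun_prop)]
  rfl

/-- The output law of the additive Gaussian channel with Gaussian input. -/
lemma complexGaussian_prod_map_mul_add (c : ℝ) (m n : ℂ) (v w : ℝ≥0) :
    ((complexGaussian m v).prod (complexGaussian n w)).map (fun p : ℂ × ℂ => (c : ℂ) * p.1 + p.2)
      = complexGaussian (c * m + n) (.mk (c ^ 2) (sq_nonneg _) * v + w) := by
  refine Measure.ext_of_lintegral _ fun F hF => ?_
  have hd : (.mk (c ^ 2) (sq_nonneg _) * v + w : ℝ≥0) / 2
      = .mk (c ^ 2) (sq_nonneg _) * (v / 2) + w / 2 := by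
    rw [add_div, mul_div_assoc]
  have h1 : ∀ (m n : ℝ) (v w : ℝ≥0) (G : ℝ → ℝ≥0∞), Measurable G →
      ∫⁻ t, G t ∂(gaussianReal (c * m + n) (.mk (c ^ 2) (sq_nonneg _) * v + w))
        = ∫⁻ x, ∫⁻ z, G (c * x + z) ∂(gaussianReal n w) ∂(gaussianReal m v) := by
    intro m n v w G hG
    rw [← gaussianReal_prod_map_mul_add, lintegral_map hG (by fun_prop),
      lintegral_prod _ (by fun_prop)]
  rw [lintegral_map hF (by fun_prop), lintegral_prod _ (by fun_prop),
    lintegral_complexGaussian _ _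
      (Measurable.lintegral_prod_right' (f := fun p : ℂ × ℂ => F (c * p.1 + p.2)) (by fun_prop)),
    lintegral_complexGaussian _ _ hF, hd]
  have hre : ((c : ℂ) * m + n).re = c * m.re + n.re := by simp
  have him : ((c : ℂ) * m + n).im = c * m.im + n.im := by simp
  have hmk : ∀ a b : ℝ, (⟨a, b⟩ : ℂ) = Complex.measurableEquivRealProd.symm (a, b) := fun _ _ => rfl
  have hS := Complex.measurableEquivRealProd.symm.measurable
  rw [hre, him, h1 _ _ _ _ _ (Measurable.lintegral_prod_right'
    (f := fun p : ℝ × ℝ => F ⟨p.1, p.2⟩) (hF.comp measurable_complexMk))]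
  refine lintegral_congr fun x1 => ?_
  have h2 : ∀ x2 : ℝ, ∫⁻ z, F (c * (⟨x1, x2⟩ : ℂ) + z) ∂(complexGaussian n w)
      = ∫⁻ z1, ∫⁻ z2, F ⟨c * x1 + z1, c * x2 + z2⟩
        ∂(gaussianReal n.im (w / 2)) ∂(gaussianReal n.re (w / 2)) := by
    intro x2
    rw [lintegral_complexGaussian _ _ (by fun_prop)]
    refine lintegral_congr fun z1 => lintegral_congr fun z2 => ?_
    congr 1
    apply Complex.ext <;> simp
  simp_rw [h2]
  -- Exchanging `x2` with `z1` puts the two real parts together and the two imaginary parts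
  -- together, so the real convolution formula `h1` applies to each coordinate.
  rw [lintegral_lintegral_swap]
  · refine lintegral_congr fun z1 => ?_
    rw [h1 _ _ _ _ (fun b => F ⟨c * x1 + z1, b⟩)
      (measurable_comp_complexMk hF measurable_const measurable_id)]
  · refine Measurable.aemeasurable ?_
    refine Measurable.lintegral_prod_right'
      (f := fun p : (ℝ × ℝ) × ℝ => F ⟨c * x1 + p.1.2, c * p.1.1 + p.2⟩) ?_
    exact measurable_comp_complexMk hF (by fun_prop) (by fun_prop)

lemma integrable_sq_sub_gaussianReal (m : ℝ) (v : ℝ≥0) :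
    Integrable (fun t => (t - m) ^ 2) (gaussianReal m v) :=
  ((memLp_id_gaussianReal' 2 (by simp)).sub (memLp_const m)).integrable_sq

lemma integral_sq_sub_gaussianReal (m : ℝ) (v : ℝ≥0) :
    ∫ t, (t - m) ^ 2 ∂(gaussianReal m v) = v := by
  have h := variance_fun_id_gaussianReal (μ := m) (v := v)
  rw [variance_eq_integral measurable_id'.aemeasurable] at h
  simpa only [integral_id_gaussianReal] using h

lemma integrable_sq_sub_complexGaussian (m : ℂ) (v : ℝ≥0) :
    Integrable (fun y => (y.re - m.re) ^ 2) (complexGaussian m v) ∧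
    Integrable (fun y => (y.im - m.im) ^ 2) (complexGaussian m v) := by
  have h1 := integrable_sq_sub_gaussianReal m.re (v / 2)
  have h2 := integrable_sq_sub_gaussianReal m.im (v / 2)
  rw [← complexGaussian_map_re] at h1
  rw [← complexGaussian_map_im] at h2
  exact ⟨h1.comp_measurable Complex.measurable_re, h2.comp_measurable Complex.measurable_im⟩

lemma normSq_sub_eq (y m : ℂ) :
    Complex.normSq (y - m) = (y.re - m.re) ^ 2 + (y.im - m.im) ^ 2 := by
  simp [Complex.normSq_apply, sq]

lemma integrable_normSq_complexGaussian (m : ℂ) (v : ℝ≥0) :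
    Integrable (fun y => Complex.normSq (y - m)) (complexGaussian m v) := by
  simp_rw [normSq_sub_eq]
  exact (integrable_sq_sub_complexGaussian m v).1.add
    (integrable_sq_sub_complexGaussian m v).2

lemma integral_normSq_complexGaussian (m : ℂ) (v : ℝ≥0) :
    ∫ y, Complex.normSq (y - m) ∂(complexGaussian m v) = v := by
  simp_rw [normSq_sub_eq]
  rw [integral_add (integrable_sq_sub_complexGaussian m v).1
    (integrable_sq_sub_complexGaussian m v).2]
  have h1 := integral_map (μ := complexGaussian m v) Complex.measurable_re.aemeasurable
    (f := fun t : ℝ => (t - m.re) ^ 2) (Measurable.aestronglyMeasurable (by fun_prop))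
  have h2 := integral_map (μ := complexGaussian m v) Complex.measurable_im.aemeasurable
    (f := fun t : ℝ => (t - m.im) ^ 2) (Measurable.aestronglyMeasurable (by fun_prop))
  rw [← h1, ← h2, complexGaussian_map_re, complexGaussian_map_im, integral_sq_sub_gaussianReal,
    integral_sq_sub_gaussianReal]
  simp

/-- Ensures that `X = 0` singles out the atom of the Bernoulli-Gaussian law, up to a null set. A
degenerate Gaussian is a point mass away from `0`; otherwise there is a density. -/
lemma complexGaussian_singleton_zero {m : ℂ} {v : ℝ≥0} (h : 0 < v ∨ m ≠ 0) :
    complexGaussian m v {0} = 0 := by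
  rcases eq_or_ne v 0 with rfl | hv
  · have hm : m ≠ 0 := by simpa using h
    rw [complexGaussian, Measure.map_apply measurable_complexMk (measurableSet_singleton _)]
    simp only [zero_div, gaussianReal_zero_var, Measure.dirac_prod_dirac]
    rw [Measure.dirac_apply' _ (measurable_complexMk (measurableSet_singleton _))]
    simpa using hm
  · rw [complexGaussian_eq_withDensity m hv]
    exact withDensity_absolutelyContinuous _ _ (by simp)


/-! ### The Gaussian channel and its information density. -/

/-- The variance of the output of the Gaussian channel with gain `c` and unit noise variance. -/
@[irreducible]
noncomputable def outputVar (c : ℝ) (v : ℝ≥0) : ℝ≥0 := .mk (c ^ 2) (sq_nonneg _) * v + 1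

lemma coe_outputVar (c : ℝ) (v : ℝ≥0) : (outputVar c v : ℝ) = c ^ 2 * v + 1 := by
  unfold outputVar; rfl

lemma outputVar_pos (c : ℝ) (v : ℝ≥0) : 0 < outputVar c v := by
  unfold outputVar; positivity

/-- The density of the joint law of input and output of the Gaussian channel with respect to the
product of the marginals. -/
noncomputable def channelRatio (c : ℝ) (m : ℂ) (v : ℝ≥0) (x y : ℂ) : ℝ :=
  complexGaussianPDF (c * x) 1 y / complexGaussianPDF (c * m) (outputVar c v) y

lemma channelRatio_pos (c : ℝ) (m : ℂ) (v : ℝ≥0) (x y : ℂ) : 0 < channelRatio c m v x y :=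
  div_pos (complexGaussianPDF_pos _ one_pos _) (complexGaussianPDF_pos _ (outputVar_pos c v) _)

lemma measurable_channelRatio (c : ℝ) (m : ℂ) (v : ℝ≥0) :
    Measurable (fun p : ℂ × ℂ => channelRatio c m v p.1 p.2) := by
  refine Measurable.div ?_ ((measurable_complexGaussianPDF _ _).comp measurable_snd)
  unfold complexGaussianPDF
  have := measurable_normSq
  fun_prop

lemma complexGaussian_output (c : ℝ) (m : ℂ) (v : ℝ≥0) :
    ((complexGaussian m v).prod (complexGaussian 0 1)).map (fun p : ℂ × ℂ => (c : ℂ) * p.1 + p.2)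
      = complexGaussian (c * m) (outputVar c v) := by
  simpa [outputVar] using complexGaussian_prod_map_mul_add c m 0 v 1

/-- The witness `(dν/dlam) F / f` does not involve `e`, so a single `G` serves both the output
density and every conditional density of the channel. -/
lemma exists_lintegral_mul_div_density {α : Type*} [MeasurableSpace α] {lam ν : Measure α}
    [SigmaFinite ν] [SigmaFinite lam] (hν : ν ≪ lam) {F f : α → ℝ≥0∞}
    (hF : Measurable F) (hf : Measurable f) :
    ∃ G : α → ℝ≥0∞, Measurable G ∧ ∀ e : α → ℝ≥0∞, Measurable e →
      ∫⁻ y, F y * (e y / f y) ∂ν = ∫⁻ y, G y ∂(lam.withDensity e) := by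
  have hqm : Measurable (ν.rnDeriv lam) := Measure.measurable_rnDeriv _ _
  refine ⟨fun y => ν.rnDeriv lam y * F y / f y, by fun_prop, fun e he => ?_⟩
  rw [lintegral_withDensity_eq_lintegral_mul _ he (by fun_prop),
    ← lintegral_rnDeriv_mul hν (by fun_prop)]
  refine lintegral_congr fun y => ?_
  simp only [Pi.mul_apply, div_eq_mul_inv]
  ring

/-- The conditional densities average over the input to the output density. With the common `G`,
both sides become the integral of `G (c x + z)` over independent input and noise. -/
lemma lintegral_channelRatio (c : ℝ) (m : ℂ) (v : ℝ≥0) {ν : Measure ℂ} [IsFiniteMeasure ν]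
    (hν : ν ≪ volume) {F : ℂ → ℝ≥0∞} (hF : Measurable F) :
    ∫⁻ x, ∫⁻ y, F y * ENNReal.ofReal (channelRatio c m v x y) ∂ν ∂(complexGaussian m v)
      = ∫⁻ y, F y ∂ν := by
  have hw := outputVar_pos c v
  have hfm := (measurable_complexGaussianPDF (c * m) (outputVar c v)).ennreal_ofReal
  obtain ⟨G, hG, hGe⟩ := exists_lintegral_mul_div_density hν hF hfm
  have hone : ∀ y, ENNReal.ofReal (complexGaussianPDF (c * m) (outputVar c v) y)
      / ENNReal.ofReal (complexGaussianPDF (c * m) (outputVar c v) y) = 1 := fun y =>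
    ENNReal.div_self (by simpa using complexGaussianPDF_pos (c * m) hw y) ENNReal.ofReal_ne_top
  have hout : ∫⁻ y, F y ∂ν = ∫⁻ x, ∫⁻ z, G (c * x + z) ∂(complexGaussian 0 1)
      ∂(complexGaussian m v) := by
    have h := hGe _ hfm
    simp only [hone, mul_one] at h
    rw [h, ← complexGaussian_eq_withDensity _ hw.ne', ← complexGaussian_output,
      lintegral_map hG (by fun_prop),
      lintegral_prod (fun p : ℂ × ℂ => G (c * p.1 + p.2)) (by fun_prop)]
  rw [hout]
  refine lintegral_congr fun x => ?_
  have h1 := complexGaussian_map_const_add (c * x) 0 1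
  rw [add_zero] at h1
  have hin := hGe _ (measurable_complexGaussianPDF (c * x) (1 : ℝ≥0)).ennreal_ofReal
  rw [← complexGaussian_eq_withDensity _ one_ne_zero, ← h1,
    lintegral_map hG (by fun_prop)] at hin
  rw [← hin]
  refine lintegral_congr fun y => ?_
  rw [channelRatio, ENNReal.ofReal_div_of_pos (complexGaussianPDF_pos _ (NNReal.coe_pos.2 hw) _),
    NNReal.coe_one]

lemma log_channelRatio (c : ℝ) (m : ℂ) (v : ℝ≥0) (x z : ℂ) :
    Real.log (channelRatio c m v x (c * x + z))
      = Real.log (outputVar c v) - Complex.normSq z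
        + Complex.normSq (c * x + z - c * m) / outputVar c v := by
  have hw : (0 : ℝ) < outputVar c v := outputVar_pos c v
  have hpi := Real.pi_pos
  rw [channelRatio, Real.log_div (complexGaussianPDF_pos _ one_pos _).ne'
    (complexGaussianPDF_pos _ hw _).ne', complexGaussianPDF, complexGaussianPDF,
    Real.log_mul (by positivity) (by positivity), Real.log_mul (by positivity) (by positivity),
    Real.log_exp, Real.log_exp, Real.log_inv, Real.log_inv, Real.log_mul hpi.ne' hw.ne',
    add_sub_cancel_left]
  simp
  ring

lemma integrable_normSq_channel (c : ℝ) (m : ℂ) (v : ℝ≥0) :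
    Integrable (fun p : ℂ × ℂ => Complex.normSq p.2)
      ((complexGaussian m v).prod (complexGaussian 0 1)) ∧
    Integrable (fun p : ℂ × ℂ => Complex.normSq (c * p.1 + p.2 - c * m))
      ((complexGaussian m v).prod (complexGaussian 0 1)) := by
  have h0 := integrable_normSq_complexGaussian 0 1
  have h1 := integrable_normSq_complexGaussian (c * m) (outputVar c v)
  simp only [sub_zero] at h0
  rw [← complexGaussian_output] at h1
  exact ⟨h0.comp_snd _, h1.comp_measurable (by fun_prop)⟩

/-- The noise energy and the output energy divided by its variance both have mean `1` and cancel,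
leaving the log variance. -/
lemma integral_log_channelRatio (c : ℝ) (m : ℂ) (v : ℝ≥0) :
    Integrable (fun p : ℂ × ℂ => Real.log (channelRatio c m v p.1 (c * p.1 + p.2)))
      ((complexGaussian m v).prod (complexGaussian 0 1)) ∧
    ∫ p : ℂ × ℂ, Real.log (channelRatio c m v p.1 (c * p.1 + p.2))
      ∂((complexGaussian m v).prod (complexGaussian 0 1)) = Real.log (outputVar c v) := by
  obtain ⟨i0, i1⟩ := integrable_normSq_channel c m v
  have hw : (0 : ℝ) < outputVar c v := outputVar_pos c v
  simp_rw [log_channelRatio]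
  have i2 : Integrable (fun p : ℂ × ℂ => Real.log (outputVar c v) - Complex.normSq p.2)
      ((complexGaussian m v).prod (complexGaussian 0 1)) := (integrable_const _).sub i0
  refine ⟨i2.add (i1.div_const _), ?_⟩
  rw [integral_add i2 (i1.div_const _), integral_sub (integrable_const _) i0, integral_div]
  have e0 : ∫ p : ℂ × ℂ, Complex.normSq p.2
      ∂((complexGaussian m v).prod (complexGaussian 0 1)) = 1 := by
    have := integral_normSq_complexGaussian 0 1
    rw [integral_fun_snd (f := Complex.normSq)]
    simpa using this
  have e1 : ∫ p : ℂ × ℂ, Complex.normSq (c * p.1 + p.2 - c * m)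
      ∂((complexGaussian m v).prod (complexGaussian 0 1)) = outputVar c v := by
    rw [← integral_normSq_complexGaussian (c * m) (outputVar c v), ← complexGaussian_output,
      integral_map (by fun_prop)]
    have := measurable_normSq
    exact Measurable.aestronglyMeasurable (by fun_prop)
  rw [e0, e1, div_self hw.ne']
  simp

/-! ### Likelihood ratios of a finite-valued observation. -/

section Likelihood

variable {α ι : Type*} [MeasurableSpace α] [Fintype ι] [MeasurableSpace ι]
  [MeasurableSingletonClass ι] {N Q : Measure α} [IsProbabilityMeasure N] [IsProbabilityMeasure Q]
  {g : α → ι}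

/-- The likelihood ratio of `N` to `Q` for the observation `g`. -/
noncomputable def likelihoodRatio (N Q : Measure α) (g : α → ι) (k : ι) : ℝ :=
  N.real (g ⁻¹' {k}) / Q.real (g ⁻¹' {k})

lemma lintegral_likelihoodRatio_le_one (hg : Measurable g) :
    ∫⁻ y, ENNReal.ofReal (likelihoodRatio N Q g (g y)) ∂Q ≤ 1 := by
  have hm : Measurable fun k => ENNReal.ofReal (likelihoodRatio N Q g k) := measurable_of_finite _
  rw [← lintegral_map (f := fun k => ENNReal.ofReal (likelihoodRatio N Q g k)) hm hg,
    lintegral_fintype]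
  have : IsProbabilityMeasure (N.map g) := Measure.isProbabilityMeasure_map hg.aemeasurable
  calc ∑ k, ENNReal.ofReal (likelihoodRatio N Q g k) * Q.map g {k}
      ≤ ∑ k, N.map g {k} := by
        refine Finset.sum_le_sum fun k _ => ?_
        rw [Measure.map_apply hg (measurableSet_singleton _),
          Measure.map_apply hg (measurableSet_singleton _), ← ofReal_measureReal,
          ← ENNReal.ofReal_mul (by unfold likelihoodRatio; positivity),
          ← ofReal_measureReal (μ := N)]
        refine ENNReal.ofReal_le_ofReal ?_
        unfold likelihoodRatio
        -- A cell that is null for `Q` contributes `0`, because division by zero gives `0`, even if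
        -- `N` charges it.
        rcases eq_or_ne (Q.real (g ⁻¹' {k})) 0 with h | h
        · simp [h]
        · rw [div_mul_cancel₀ _ h]
    _ = 1 := by
        simp

-- There are finitely many cells, so almost every point lies in one that `N` charges, and `Q`
-- charges it too by absolute continuity.
omit [MeasurableSpace ι] [MeasurableSingletonClass ι] in
lemma likelihoodRatio_pos (hac : N ≪ Q) :
    ∀ᵐ y ∂N, 0 < likelihoodRatio N Q g (g y) := by
  have h : ∀ᵐ y ∂N, ∀ k, N (g ⁻¹' {k}) = 0 → g y ≠ k := by
    rw [ae_all_iff]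
    intro k
    by_cases hk : N (g ⁻¹' {k}) = 0
    · simp only [hk, forall_const]
      exact measure_eq_zero_iff_ae_notMem.mp hk
    · simp [hk]
  filter_upwards [h] with y hy
  have h1 : N (g ⁻¹' {g y}) ≠ 0 := fun h0 => hy _ h0 rfl
  have h2 : Q (g ⁻¹' {g y}) ≠ 0 := fun h0 => h1 (hac h0)
  exact div_pos (ENNReal.toReal_pos h1 (measure_ne_top _ _))
    (ENNReal.toReal_pos h2 (measure_ne_top _ _))

omit [IsProbabilityMeasure Q] in
lemma integral_log_likelihoodRatio (hg : Measurable g) :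
    Integrable (fun y => Real.log (likelihoodRatio N Q g (g y))) N ∧
    ∫ y, Real.log (likelihoodRatio N Q g (g y)) ∂N
      = ∑ k, N.real (g ⁻¹' {k}) * Real.log (likelihoodRatio N Q g k) := by
  have : IsProbabilityMeasure (N.map g) := Measure.isProbabilityMeasure_map hg.aemeasurable
  have hi : Integrable (fun k => Real.log (likelihoodRatio N Q g k)) (N.map g) :=
    Integrable.of_finite
  refine ⟨hi.comp_measurable hg, ?_⟩
  rw [← integral_map (f := fun k => Real.log (likelihoodRatio N Q g k)) hg.aemeasurable
    hi.aestronglyMeasurable, integral_fintype hi]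
  refine Finset.sum_congr rfl fun k _ => ?_
  rw [map_measureReal_apply hg (measurableSet_singleton _), smul_eq_mul]

end Likelihood


/-! ### Joint law of the channel with Bernoulli-Gaussian input. -/

/-- The joint law of input and output of the Gaussian channel with gain `c` and input law `κ`. -/
noncomputable def channelJoint (c : ℝ) (κ : Measure ℂ) : Measure (ℂ × ℂ) :=
  (κ.prod (complexGaussian 0 1)).map (fun p => (p.1, (c : ℂ) * p.1 + p.2))

instance (c : ℝ) (κ : Measure ℂ) [IsProbabilityMeasure κ] :
    IsProbabilityMeasure (channelJoint c κ) :=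
  Measure.isProbabilityMeasure_map (by fun_prop)

lemma channelJoint_fst (c : ℝ) (κ : Measure ℂ) [SFinite κ] :
    (channelJoint c κ).map Prod.fst = κ := by
  rw [channelJoint, Measure.map_map (by fun_prop) (by fun_prop)]
  exact Measure.fst_prod

lemma channelJoint_dirac_zero (c : ℝ) :
    channelJoint c (Measure.dirac 0) = (complexGaussian 0 1).map (fun z => ((0 : ℂ), z)) := by
  rw [channelJoint, Measure.dirac_prod, Measure.map_map (by fun_prop) (by fun_prop)]
  congr 1
  ext z <;> simp

lemma channelJoint_complexGaussian_snd (c : ℝ) (m : ℂ) (v : ℝ≥0) :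
    (channelJoint c (complexGaussian m v)).map Prod.snd
      = complexGaussian (c * m) (outputVar c v) := by
  rw [channelJoint, Measure.map_map (by fun_prop) (by fun_prop), ← complexGaussian_output]
  rfl

lemma channelJoint_bernoulliGaussian (c : ℝ) (m : ℂ) (v : ℝ≥0) (γ : ℝ) :
    channelJoint c (bernoulliGaussian m v γ)
      = ENNReal.ofReal (1 - γ) • channelJoint c (Measure.dirac 0)
        + ENNReal.ofReal γ • channelJoint c (complexGaussian m v) := by
  rw [channelJoint, bernoulliGaussian, Measure.add_prod, Measure.prod_smul_left,
    Measure.prod_smul_left, Measure.map_add _ _ (by fun_prop), Measure.map_smul, Measure.map_smul]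
  rfl

lemma channelJoint_bernoulliGaussian_snd (c : ℝ) (m : ℂ) (v : ℝ≥0) (γ : ℝ) :
    (channelJoint c (bernoulliGaussian m v γ)).map Prod.snd
      = ENNReal.ofReal (1 - γ) • complexGaussian 0 1
        + ENNReal.ofReal γ • complexGaussian (c * m) (outputVar c v) := by
  rw [channelJoint_bernoulliGaussian, Measure.map_add _ _ (by fun_prop), Measure.map_smul,
    Measure.map_smul, channelJoint_complexGaussian_snd, channelJoint_dirac_zero,
    Measure.map_map (by fun_prop) (by fun_prop)]
  congr 2
  exact Measure.map_id

lemma isProbabilityMeasure_bernoulliGaussian (m : ℂ) (v : ℝ≥0) {γ : ℝ} (h0 : 0 ≤ γ) (h1 : γ ≤ 1) :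
    IsProbabilityMeasure (bernoulliGaussian m v γ) := by
  constructor
  simp only [bernoulliGaussian, Measure.add_apply, Measure.smul_apply, measure_univ, smul_eq_mul,
    mul_one]
  rw [← ENNReal.ofReal_add (by linarith) h0]
  simp

lemma ae_fst_ne_zero_channelJoint (c : ℝ) {m : ℂ} {v : ℝ≥0} (h : 0 < v ∨ m ≠ 0) :
    ∀ᵐ p ∂(channelJoint c (complexGaussian m v)), p.1 ≠ 0 := by
  have : ∀ᵐ x ∂((channelJoint c (complexGaussian m v)).map Prod.fst), x ≠ 0 := by
    rw [channelJoint_fst]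
    exact measure_eq_zero_iff_ae_notMem.mp (complexGaussian_singleton_zero h)
  exact ae_of_ae_map (f := Prod.fst) (p := fun x => x ≠ 0) (by fun_prop) this

/-- Only the atom charges `x = 0`. With `channelJoint_present`, this identifies the conditional
output laws given absence and presence. -/
lemma channelJoint_absent (c : ℝ) {m : ℂ} {v : ℝ≥0} (h : 0 < v ∨ m ≠ 0) (γ : ℝ) {A : Set ℂ}
    (hA : MeasurableSet A) :
    channelJoint c (bernoulliGaussian m v γ) ({0} ×ˢ A)
      = ENNReal.ofReal (1 - γ) * complexGaussian 0 1 A := by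
  have h0 : channelJoint c (complexGaussian m v) ({0} ×ˢ A) = 0 := by
    rw [measure_eq_zero_iff_ae_notMem]
    filter_upwards [ae_fst_ne_zero_channelJoint c h] with p hp hpA
    exact hp hpA.1
  rw [channelJoint_bernoulliGaussian, Measure.add_apply, Measure.smul_apply, Measure.smul_apply, h0,
    channelJoint_dirac_zero,
    Measure.map_apply (by fun_prop) ((measurableSet_singleton _).prod hA)]
  simp [Set.preimage]

lemma channelJoint_present (c : ℝ) {m : ℂ} {v : ℝ≥0} (h : 0 < v ∨ m ≠ 0) (γ : ℝ) {A : Set ℂ}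
    (hA : MeasurableSet A) :
    channelJoint c (bernoulliGaussian m v γ) ({0}ᶜ ×ˢ A)
      = ENNReal.ofReal γ * complexGaussian (c * m) (outputVar c v) A := by
  have h0 : channelJoint c (complexGaussian m v) ({0}ᶜ ×ˢ A)
      = complexGaussian (c * m) (outputVar c v) A := by
    rw [← channelJoint_complexGaussian_snd, Measure.map_apply (by fun_prop) hA]
    refine measure_congr ?_
    filter_upwards [ae_fst_ne_zero_channelJoint c h] with p hp
    apply propext
    change p ∈ ({0}ᶜ : Set ℂ) ×ˢ A ↔ p.2 ∈ A
    simp [hp]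
  rw [channelJoint_bernoulliGaussian, Measure.add_apply, Measure.smul_apply, Measure.smul_apply, h0,
    channelJoint_dirac_zero,
    Measure.map_apply (by fun_prop) ((measurableSet_singleton _).compl.prod hA)]
  simp [Set.preimage]

/-! ### The divergence bound for the joint law. -/

/-- The information in nats that the observation with likelihood ratios `likelihoodRatio N Q g`
carries about `N` against the reference `Q`. -/
noncomputable def detectionDivergence {ι : Type*} [Fintype ι] (N Q : Measure ℂ) (g : ℂ → ι) : ℝ :=
  ∑ k, N.real (g ⁻¹' {k}) * Real.log (likelihoodRatio N Q g k)

/-- The Gibbs bound for the test function `H` below, evaluated separately on the atom and on the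
Gaussian component. -/
lemma le_toReal_klDiv_channelJoint {ι : Type*} [Fintype ι] [MeasurableSpace ι]
    [MeasurableSingletonClass ι] (c : ℝ) {m : ℂ} {v : ℝ≥0} (h : 0 < v ∨ m ≠ 0) {γ : ℝ}
    (hγ0 : 0 < γ) (hγ1 : γ < 1) {g : ℂ → ι} (hg : Measurable g) {ν : Measure ℂ}
    (hν : ν = ENNReal.ofReal (1 - γ) • complexGaussian 0 1
        + ENNReal.ofReal γ • complexGaussian (c * m) (outputVar c v))
    [IsProbabilityMeasure ν]
    (hac : channelJoint c (bernoulliGaussian m v γ) ≪ (bernoulliGaussian m v γ).prod ν)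
    (hllr : Integrable (llr (channelJoint c (bernoulliGaussian m v γ))
      ((bernoulliGaussian m v γ).prod ν)) (channelJoint c (bernoulliGaussian m v γ))) :
    (1 - γ) * detectionDivergence (complexGaussian 0 1) ν g
      + γ * (detectionDivergence (complexGaussian (c * m) (outputVar c v)) ν g
        + Real.log (outputVar c v))
      ≤ (InformationTheory.klDiv (channelJoint c (bernoulliGaussian m v γ))
          ((bernoulliGaussian m v γ).prod ν)).toReal := by
  have hw := outputVar_pos c v
  have hP := isProbabilityMeasure_bernoulliGaussian m v hγ0.le hγ1.le
  have h1γ : 0 < 1 - γ := by linarith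
  have ha : ENNReal.ofReal (1 - γ) ≠ 0 := by simpa using h1γ
  have hb : ENNReal.ofReal γ ≠ 0 := by simpa using hγ0
  set N0 := complexGaussian 0 1 with hN0
  set N1 := complexGaussian (c * m) (outputVar c v) with hN1
  have hac0 : N0 ≪ ν := by
    rw [hν]
    exact (Measure.absolutelyContinuous_smul ha).trans (Measure.AbsolutelyContinuous.rfl.add_right _)
  have hac1 : N1 ≪ ν := by
    rw [hν, add_comm]
    exact (Measure.absolutelyContinuous_smul hb).trans (Measure.AbsolutelyContinuous.rfl.add_right _)
  have hvol : ν ≪ volume := by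
    have e0 : N0 ≪ volume := by
      rw [hN0, complexGaussian_eq_withDensity _ one_ne_zero]
      exact withDensity_absolutelyContinuous _ _
    have e1 : N1 ≪ volume := by
      rw [hN1, complexGaussian_eq_withDensity _ hw.ne']
      exact withDensity_absolutelyContinuous _ _
    rw [hν]
    exact Measure.AbsolutelyContinuous.add_left (e0.smul_left _) (e1.smul_left _)
  set A0 : ℂ → ℝ := fun y => likelihoodRatio N0 ν g (g y) with hA0
  set A1 : ℂ → ℝ := fun y => likelihoodRatio N1 ν g (g y) with hA1
  have hA0m : Measurable A0 :=
    (measurable_of_finite (likelihoodRatio N0 ν g)).comp hg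
  have hA1m : Measurable A1 :=
    (measurable_of_finite (likelihoodRatio N1 ν g)).comp hg
  have hA1nn : ∀ y, 0 ≤ A1 y := fun y => by simp only [hA1, likelihoodRatio]; positivity
  -- Approximates the true density of the joint law: the ratio of `N0` or `N1` to `ν` is replaced by
  -- its coarse version through `g`, while the channel density relative to `N1` is kept exactly.
  set H : ℂ × ℂ → ℝ := fun p =>
    if p.1 = 0 then A0 p.2 else A1 p.2 * channelRatio c m v p.1 p.2 with hH
  have hrm := measurable_channelRatio c m v
  have hHm : Measurable H :=
    Measurable.ite (measurableSet_eq_fun measurable_fst measurable_const) (hA0m.comp measurable_snd)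
      ((hA1m.comp measurable_snd).mul hrm)
  have hne := ae_fst_ne_zero_channelJoint c h
  have hsnd : N1 = (channelJoint c (complexGaussian m v)).map Prod.snd :=
    (channelJoint_complexGaussian_snd c m v).symm
  have hpos0 : ∀ᵐ p ∂(channelJoint c (Measure.dirac 0)), 0 < H p := by
    rw [channelJoint_dirac_zero,
      ae_map_iff (by fun_prop) (measurableSet_lt measurable_const hHm)]
    simpa [hH] using likelihoodRatio_pos (g := g) hac0
  have hpos1 : ∀ᵐ p ∂(channelJoint c (complexGaussian m v)), 0 < A1 p.2 := by
    have hpos : ∀ᵐ y ∂((channelJoint c (complexGaussian m v)).map Prod.snd), 0 < A1 y :=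
      hsnd ▸ likelihoodRatio_pos (g := g) hac1
    exact ae_of_ae_map (f := Prod.snd) (p := fun y => 0 < A1 y) (by fun_prop) hpos
  have hlog0 : Integrable (fun p => Real.log (H p)) (channelJoint c (Measure.dirac 0)) ∧
      ∫ p, Real.log (H p) ∂(channelJoint c (Measure.dirac 0)) = detectionDivergence N0 ν g := by
    have hlm : AEStronglyMeasurable (fun p => Real.log (H p))
      (Measure.map (fun z => ((0 : ℂ), z)) (complexGaussian 0 1)) :=
      Measurable.aestronglyMeasurable (by fun_prop)
    rw [channelJoint_dirac_zero, integrable_map_measure hlm (by fun_prop),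
      integral_map (by fun_prop) hlm]
    simp only [hH, Function.comp_def, if_true]
    exact integral_log_likelihoodRatio hg
  have hlog1 : Integrable (fun p => Real.log (H p)) (channelJoint c (complexGaussian m v)) ∧
      ∫ p, Real.log (H p) ∂(channelJoint c (complexGaussian m v))
        = detectionDivergence N1 ν g + Real.log (outputVar c v) := by
    have heq : (fun p => Real.log (H p)) =ᵐ[channelJoint c (complexGaussian m v)]
        fun p => Real.log (A1 p.2) + Real.log (channelRatio c m v p.1 p.2) := by
      filter_upwards [hne, hpos1] with p hp hp1
      simp only [hH, if_neg hp]
      rw [Real.log_mul hp1.ne' (channelRatio_pos c m v _ _).ne']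
    obtain ⟨iA, eA⟩ := integral_log_likelihoodRatio (N := N1) (Q := ν) hg
    have iA' : Integrable (fun p : ℂ × ℂ => Real.log (A1 p.2))
        (channelJoint c (complexGaussian m v)) := by
      have : Integrable (fun y => Real.log (A1 y))
        ((channelJoint c (complexGaussian m v)).map Prod.snd) := hsnd ▸ iA
      exact this.comp_measurable measurable_snd
    have eA' : ∫ p : ℂ × ℂ, Real.log (A1 p.2) ∂(channelJoint c (complexGaussian m v))
        = detectionDivergence N1 ν g := by
      rw [← integral_map (φ := Prod.snd) (f := fun y => Real.log (A1 y)) (by fun_prop)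
        (Measurable.aestronglyMeasurable (by fun_prop)), ← hsnd]
      exact eA
    obtain ⟨iR, eR⟩ := integral_log_channelRatio c m v
    have hRm : AEStronglyMeasurable (fun p : ℂ × ℂ => Real.log (channelRatio c m v p.1 p.2))
        (channelJoint c (complexGaussian m v)) :=
      (Real.measurable_log.comp hrm).aestronglyMeasurable
    have iR' : Integrable (fun p : ℂ × ℂ => Real.log (channelRatio c m v p.1 p.2))
        (channelJoint c (complexGaussian m v)) := by
      rw [channelJoint] at hRm ⊢
      rw [integrable_map_measure hRm (by fun_prop)]
      exact iR
    have eR' : ∫ p : ℂ × ℂ, Real.log (channelRatio c m v p.1 p.2)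
        ∂(channelJoint c (complexGaussian m v)) = Real.log (outputVar c v) := by
      rw [channelJoint] at hRm ⊢
      rw [integral_map (by fun_prop) hRm]
      exact eR
    refine ⟨(iA'.add iR').congr heq.symm, ?_⟩
    rw [integral_congr_ae heq, integral_add iA' iR', eA', eR']
  have hmass : ∫⁻ p, ENNReal.ofReal (H p) ∂((bernoulliGaussian m v γ).prod ν) ≤ 1 := by
    -- Almost every Gaussian input is nonzero, so only the second branch of `H` counts, and its
    -- channel factor averages out.
    have m1 : ∫⁻ x, ∫⁻ y, ENNReal.ofReal (H (x, y)) ∂ν ∂(complexGaussian m v) ≤ 1 := by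
      calc ∫⁻ x, ∫⁻ y, ENNReal.ofReal (H (x, y)) ∂ν ∂(complexGaussian m v)
          = ∫⁻ x, ∫⁻ y, ENNReal.ofReal (A1 y) * ENNReal.ofReal (channelRatio c m v x y)
              ∂ν ∂(complexGaussian m v) := by
            refine lintegral_congr_ae ?_
            filter_upwards [measure_eq_zero_iff_ae_notMem.mp (complexGaussian_singleton_zero h)]
              with x hx
            refine lintegral_congr fun y => ?_
            rw [← ENNReal.ofReal_mul (hA1nn y)]
            simp only [hH]
            rw [if_neg (show x ≠ 0 from hx)]
        _ = ∫⁻ y, ENNReal.ofReal (A1 y) ∂ν :=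
            lintegral_channelRatio c m v hvol hA1m.ennreal_ofReal
        _ ≤ 1 := lintegral_likelihoodRatio_le_one hg
    have m0 : ∫⁻ x, ∫⁻ y, ENNReal.ofReal (H (x, y)) ∂ν ∂(Measure.dirac 0) ≤ 1 := by
      rw [lintegral_dirac]
      simpa [hH] using lintegral_likelihoodRatio_le_one (N := N0) (Q := ν) hg
    rw [lintegral_prod _ (by fun_prop), bernoulliGaussian, lintegral_add_measure,
      lintegral_smul_measure, lintegral_smul_measure]
    calc _ ≤ ENNReal.ofReal (1 - γ) • (1 : ℝ≥0∞) + ENNReal.ofReal γ • (1 : ℝ≥0∞) := by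
          gcongr
      _ = 1 := by
          rw [smul_eq_mul, smul_eq_mul, mul_one, mul_one, ← ENNReal.ofReal_add h1γ.le hγ0.le]
          simp
  have hpos : ∀ᵐ p ∂(channelJoint c (bernoulliGaussian m v γ)), 0 < H p := by
    rw [channelJoint_bernoulliGaussian, ae_add_measure_iff]
    refine ⟨Measure.ae_smul_measure hpos0 _, Measure.ae_smul_measure ?_ _⟩
    filter_upwards [hne, hpos1] with p hp hp1
    simp only [hH, if_neg hp]
    exact mul_pos hp1 (channelRatio_pos c m v _ _)
  have i0 := hlog0.1.smul_measure (c := ENNReal.ofReal (1 - γ)) ENNReal.ofReal_ne_top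
  have i1 := hlog1.1.smul_measure (c := ENNReal.ofReal γ) ENNReal.ofReal_ne_top
  have hint : Integrable (fun p => Real.log (H p)) (channelJoint c (bernoulliGaussian m v γ)) := by
    rw [channelJoint_bernoulliGaussian]
    exact i0.add_measure i1
  have hval : ∫ p, Real.log (H p) ∂(channelJoint c (bernoulliGaussian m v γ))
      = (1 - γ) * detectionDivergence N0 ν g
        + γ * (detectionDivergence N1 ν g + Real.log (outputVar c v)) := by
    rw [channelJoint_bernoulliGaussian, integral_add_measure i0 i1, integral_smul_measure,
      integral_smul_measure, hlog0.2, hlog1.2, ENNReal.toReal_ofReal h1γ.le,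
      ENNReal.toReal_ofReal hγ0.le, smul_eq_mul, smul_eq_mul]
  rw [← hval]
  exact integral_log_le_toReal_klDiv hac hllr hHm hpos hint hmass

/-! ### Transfer to random variables and binary entropies. -/

lemma map_received {Ω : Type*} [MeasurableSpace Ω] (P : Measure Ω) [IsProbabilityMeasure P] {snr : ℝ} {X Z : Ω → ℂ}
    (hX : Measurable X) (hZ : Measurable Z) (hZlaw : P.map Z = complexGaussian 0 1)
    (hXZ : IndepFun X Z P) :
    P.map (fun ω => (X ω, received snr X Z ω)) = channelJoint (Real.sqrt snr) (P.map X) := by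
  rw [channelJoint, ← hZlaw,
    ← (indepFun_iff_map_prod_eq_prod_map_map hX.aemeasurable hZ.aemeasurable).mp hXZ,
    Measure.map_map (by fun_prop) (by fun_prop)]
  rfl

/-- The hypothesis excludes `p = 0` with `a ≠ 0`, where `a / 0 = 0` and `log 0 = 0` would break the
identity. -/
lemma mul_log_div_eq {a p : ℝ} (h : p = 0 → a = 0) :
    a * Real.log (a / p) = a * Real.log a - a * Real.log p := by
  rcases eq_or_ne a 0 with rfl | ha
  · simp
  · rw [Real.log_div ha (fun hp => ha (h hp))]
    ring

lemma Hb_eq (p : ℝ) :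
    Hb p = -(p * Real.log p + (1 - p) * Real.log (1 - p)) / Real.log 2 := by
  simp only [Hb, Real.logb]
  ring

/-- The detection part of the bound, expressed through binary entropies. -/
lemma Hb_sub_HNP_eq {γ a b : ℝ} (hγ0 : 0 < γ) (hγ1 : γ < 1) (ha0 : 0 ≤ a) (ha1 : a ≤ 1)
    (hb0 : 0 ≤ b) (hb1 : b ≤ 1) :
    Hb γ - HNP γ a b
      = ((1 - γ) * ((1 - a) * Real.log ((1 - a) / ((1 - γ) * (1 - a) + γ * b))
            + a * Real.log (a / ((1 - γ) * a + γ * (1 - b))))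
          + γ * (b * Real.log (b / ((1 - γ) * (1 - a) + γ * b))
            + (1 - b) * Real.log ((1 - b) / ((1 - γ) * a + γ * (1 - b))))) / Real.log 2 := by
  have h1γ : 0 < 1 - γ := by linarith
  -- Both weights are positive, so an outcome of zero probability under the mixture has zero
  -- probability under each component, as `mul_log_div_eq` requires.
  have key : ∀ s t : ℝ, 0 ≤ s → 0 ≤ t → (1 - γ) * s + γ * t = 0 → s = 0 ∧ t = 0 := by
    intro s t hs ht hst
    have h1 : 0 ≤ (1 - γ) * s := by positivity
    have h2 : 0 ≤ γ * t := by positivity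
    have h3 : (1 - γ) * s = 0 := by linarith
    have h4 : γ * t = 0 := by linarith
    exact ⟨(mul_eq_zero.mp h3).resolve_left h1γ.ne', (mul_eq_zero.mp h4).resolve_left hγ0.ne'⟩
  have k0 := key (1 - a) b (by linarith) hb0
  have k1 := key a (1 - b) ha0 (by linarith)
  rw [mul_log_div_eq fun h => (k0 h).1, mul_log_div_eq fun h => (k1 h).1,
    mul_log_div_eq fun h => (k0 h).2, mul_log_div_eq fun h => (k1 h).2]
  -- The two outcome probabilities of the mixture sum to `1`, so their log terms form one binary
  -- entropy.
  have e : (1 - γ) * (1 - a) + γ * b = 1 - ((1 - γ) * a + γ * (1 - b)) := by ring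
  simp only [HNP, Hb_eq]
  rw [e]
  ring

end BGSensing

/-! ### Assembly. -/

theorem theorem3 {Ω : Type*} [MeasurableSpace Ω] (P : Measure Ω) [IsProbabilityMeasure P]
    (γ : ℝ) (hγ0 : 0 < γ) (hγ1 : γ < 1)
    (μT : ℂ) (σsq : ℝ≥0) (hT : 0 < σsq ∨ μT ≠ 0)
    (snr : ℝ) (hsnr : 0 ≤ snr)
    (X Z : Ω → ℂ) (hX : Measurable X) (hZ : Measurable Z)
    (hXlaw : P.map X = BGSensing.bernoulliGaussian μT σsq γ)
    (hZlaw : P.map Z = BGSensing.complexGaussian 0 1)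
    (hXZ : IndepFun X Z P)
    (δ : ℝ) (g : ℂ → Fin 2)
    (hg : BGSensing.IsNeymanPearson P X (BGSensing.received snr X Z) γ δ g) :
    ((BGSensing.Hb γ
        - BGSensing.HNP γ (BGSensing.probFA P X (BGSensing.received snr X Z) g)
            (BGSensing.probMD P X (BGSensing.received snr X Z) g)
        + γ * Real.logb 2 (1 + snr * (σsq : ℝ)) : ℝ) : EReal)
      ≤ ((BGSensing.mutualInfoBits P X (BGSensing.received snr X Z) : ℝ≥0∞) : EReal) := by
  open BGSensing in
  have hgm : Measurable g := hg.1
  set c := Real.sqrt snr with hc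
  set Y := received snr X Z with hYdef
  have hYm : Measurable Y := by
    rw [hYdef]; unfold received; fun_prop
  set N0 := complexGaussian 0 1
  set N1 := complexGaussian (c * μT) (outputVar c σsq) with hN1
  set ν := P.map Y with hνdef
  have h1γ : 0 < 1 - γ := by linarith
  have hJ : P.map (fun ω => (X ω, Y ω)) = channelJoint c (bernoulliGaussian μT σsq γ) := by
    rw [← hXlaw]; exact map_received P hX hZ hZlaw hXZ
  have hνJ : ν = (P.map (fun ω => (X ω, Y ω))).map Prod.snd := by
    rw [Measure.map_map (by fun_prop) (by fun_prop)]; rfl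
  have hν : ν = ENNReal.ofReal (1 - γ) • N0 + ENNReal.ofReal γ • N1 := by
    rw [hνJ, hJ, channelJoint_bernoulliGaussian_snd]
  have hνP : IsProbabilityMeasure ν := Measure.isProbabilityMeasure_map hYm.aemeasurable
  have hmem : ∀ B A : Set ℂ, MeasurableSet B → MeasurableSet A →
      P (X ⁻¹' B ∩ Y ⁻¹' A) = channelJoint c (bernoulliGaussian μT σsq γ) (B ×ˢ A) := by
    intro B A hB hA
    rw [← hJ, Measure.map_apply (by fun_prop) (hB.prod hA)]
    rfl
  have hms : ∀ k, MeasurableSet (g ⁻¹' {k}) := fun k => hgm (measurableSet_singleton k)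
  have hX0 : P (X ⁻¹' {0}) = ENNReal.ofReal (1 - γ) := by
    have := hmem {0} Set.univ (measurableSet_singleton _) MeasurableSet.univ
    rw [channelJoint_absent c hT γ MeasurableSet.univ] at this
    simpa using this
  have hX1 : P (X ⁻¹' {0}ᶜ) = ENNReal.ofReal γ := by
    have := hmem {0}ᶜ Set.univ (measurableSet_singleton _).compl MeasurableSet.univ
    rw [channelJoint_present c hT γ MeasurableSet.univ] at this
    simpa using this
  have hFA : probFA P X Y g = N0.real (g ⁻¹' {1}) := by
    have e := hmem {0} (g ⁻¹' {1}) (measurableSet_singleton _) (hms 1)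
    rw [channelJoint_absent c hT γ (hms 1)] at e
    change (ProbabilityTheory.cond P (X ⁻¹' {0})).real (Y ⁻¹' (g ⁻¹' {1})) = _
    rw [measureReal_def, cond_apply (hX (measurableSet_singleton _)), e, hX0, ← mul_assoc,
      ENNReal.inv_mul_cancel (by simpa using h1γ) ENNReal.ofReal_ne_top, one_mul]
    rfl
  have hMD : probMD P X Y g = N1.real (g ⁻¹' {0}) := by
    have e := hmem {0}ᶜ (g ⁻¹' {0}) (measurableSet_singleton _).compl (hms 0)
    rw [channelJoint_present c hT γ (hms 0)] at e
    change (ProbabilityTheory.cond P (X ⁻¹' {0}ᶜ)).real (Y ⁻¹' (g ⁻¹' {0})) = _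
    rw [measureReal_def, cond_apply (hX (measurableSet_singleton _).compl), e, hX1, ← mul_assoc,
      ENNReal.inv_mul_cancel (by simpa using hγ0) ENNReal.ofReal_ne_top, one_mul]
    rfl
  have hcompl : (g ⁻¹' {0})ᶜ = g ⁻¹' {1} := by
    ext y
    simp only [Set.mem_compl_iff, Set.mem_preimage, Set.mem_singleton_iff]
    generalize g y = k
    fin_cases k <;> simp
  have hN00 : N0.real (g ⁻¹' {0}) = 1 - N0.real (g ⁻¹' {1}) := by
    rw [← hcompl, probReal_compl_eq_one_sub (hms 0)]; ring
  have hN11 : N1.real (g ⁻¹' {1}) = 1 - N1.real (g ⁻¹' {0}) := by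
    rw [← hcompl, probReal_compl_eq_one_sub (hms 0)]
  have hνk : ∀ k, ν.real (g ⁻¹' {k})
      = (1 - γ) * N0.real (g ⁻¹' {k}) + γ * N1.real (g ⁻¹' {k}) := by
    intro k
    rw [hν, measureReal_def, Measure.add_apply, Measure.smul_apply, Measure.smul_apply,
      smul_eq_mul, smul_eq_mul, ENNReal.toReal_add (by finiteness) (by finiteness),
      ENNReal.toReal_mul, ENNReal.toReal_mul, ENNReal.toReal_ofReal h1γ.le,
      ENNReal.toReal_ofReal hγ0.le]
    rfl
  have hwv : (1 + snr * (σsq : ℝ)) = outputVar c σsq := by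
    rw [coe_outputVar, hc, Real.sq_sqrt hsnr]; ring
  have hlog2 : 0 < Real.log 2 := Real.log_pos one_lt_two
  rw [hFA, hMD, Hb_sub_HNP_eq hγ0 hγ1 measureReal_nonneg measureReal_le_one measureReal_nonneg
    measureReal_le_one, hwv, mutualInfoBits, hJ, hXlaw]
  -- An infinite divergence makes the bound trivial but must be split off, since its `toReal` is
  -- `0`. Finiteness supplies the absolute continuity and integrability that the Gibbs bound needs.
  by_cases htop : InformationTheory.klDiv (channelJoint c (bernoulliGaussian μT σsq γ))
      ((bernoulliGaussian μT σsq γ).prod ν) = ∞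
  · rw [htop, ENNReal.top_div_of_ne_top ENNReal.ofReal_ne_top]
    simp
  · obtain ⟨hac, hllr⟩ := InformationTheory.klDiv_ne_top_iff.mp htop
    have hmain := le_toReal_klDiv_channelJoint c hT hγ0 hγ1 hgm hν hac hllr
    rw [← ENNReal.ofReal_toReal htop, ← ENNReal.ofReal_div_of_pos hlog2,
      EReal.coe_ennreal_ofReal, max_eq_left (by positivity), EReal.coe_le_coe_iff]
    simp only [detectionDivergence, likelihoodRatio, Fin.sum_univ_two, hνk] at hmain
    rw [← hN1] at hmain
    rw [hN00, hN11] at hmain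
    rw [Real.logb, mul_div_assoc', ← add_div]
    refine div_le_div_of_nonneg_right ?_ hlog2.le
    linarith
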